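/- Let $R$ be a commutative ring, $S$ a (not necessarily commutative) $R$-algebra that is finitely generated as an $R$-module, $M$ a right $S$-module, and $N$ a finitely generated right $S$-module. For a right $S$-module $M'$, an $R$-submodule $H$ of $\operatorname{Hom}_S(M',N)$ and $\mathfrak p\in\operatorname{Spec}(R)$, let $\partial(H)$ be the supremum of the integers $t\ge 0$ for which there is a surjective $f\in H^{\oplus t}\subseteq\operatorname{Hom}_S(M',N^{\oplus t})$, and let $\partial_{\mathfrak p}(H)$ be the supremum of the integers $t\ge 0$ for which there is $f\in H^{\oplus t}$ whose localization $f_{\mathfrak p}$ is surjective. A subset $X\subseteq\operatorname{Spec}(R)$ is a basic set for $R$ if $X$ is a Noetherian space and every $\mathfrak p\in\operatorname{Spec}(R)$ that is an intersection of members of $X$ belongs to $X$. For $\mathfrak p\in X$, let $\dim_X(\mathfrak p)$ be the Krull dimension of the space $\{\mathfrak q\in X:\mathfrak p\subseteq\mathfrak q\}$. **Theorem.** Let $L$ be an $S$-submodule of $M$, let $F$ be a finitely generated $R$-submodule of $\operatorname{Hom}_S(L,N)$, and let $G$ be an $R$-submodule of $\operatorname{Hom}_S(M,N)$. Suppose that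 every member of $F$ can be extended to a member of $G$. Let $X$ be a subset of $\operatorname{Supp}_R(N)$ that is a basic set for $R$, and suppose that $\dim(X)<\infty$. Then the following statements hold: (1) Let $t$ be a positive integer, and suppose that $\partial_{\mathfrak p}(F)\ge t+\dim_X(\mathfrak p)$ for every $\mathfrak p\in X$. Then there exists $g\in G^{\oplus t}$ such that $g_{\mathfrak p}$ is surjective for every $\mathfrak p\in X$. (2) Suppose that $\operatorname{Max}(R)\cap\operatorname{Supp}_R(N)\subseteq X$. Then $$\partial(G)\ge\inf\{\partial_{\mathfrak p}(F)-\dim_X(\mathfrak p):\mathfrak p\in X\},$$ where the infimum is taken in the extended real line (so it is $\infty$ if $X=\varnothing$). -/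

import Mathlib

namespace SurjectiveCapacity

/-- A subset `X` of `Spec R` is a basic set for `R` if `X` is Noetherian in the subspace topology
and contains every prime that is an intersection of members of `X`. -/
def IsBasicSet {R : Type*} [CommRing R] (X : Set (PrimeSpectrum R)) : Prop :=
  TopologicalSpace.NoetherianSpace X ∧
    ∀ (p : PrimeSpectrum R) (Y : Set (PrimeSpectrum R)),
      Y ⊆ X → p.asIdeal = ⨅ q ∈ Y, q.asIdeal → p ∈ X

/-- `dim_X(p)`: the Krull dimension of the space `V(p) ∩ X`. -/
noncomputable def dimAt {R : Type*} [CommRing R] (X : Set (PrimeSpectrum R))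
    (p : PrimeSpectrum R) : WithBot ℕ∞ :=
  topologicalKrullDim ↥(PrimeSpectrum.zeroLocus (p.asIdeal : Set R) ∩ X)

/-- The order embedding of `{-∞} ∪ ℕ ∪ {∞}` in the extended reals. -/
noncomputable def toEReal : WithBot ℕ∞ → EReal
  | ⊥ => ⊥
  | (n : ℕ∞) => (n : EReal)

section Capacity

/- Right `S`-modules are modules over the opposite ring `Sᵐᵒᵖ`. -/
variable {R S M N : Type*} [CommRing R] [Ring S] [Algebra R S]
  [AddCommGroup M] [Module R M] [Module Sᵐᵒᵖ M] [IsScalarTower R Sᵐᵒᵖ M]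
  [AddCommGroup N] [Module R N] [Module Sᵐᵒᵖ N] [IsScalarTower R Sᵐᵒᵖ N]

/-- For `f = (f₁, …, f_t)` with `fᵢ : M → N`, regarded as a map `M → N^t`, the localization
`f_p : M_p → (N^t)_p` is surjective. -/
def SurjectiveAt (p : PrimeSpectrum R) {t : ℕ} (f : Fin t → (M →ₗ[Sᵐᵒᵖ] N)) : Prop :=
  Function.Surjective
    (LocalizedModule.map p.asIdeal.primeCompl ((LinearMap.pi f).restrictScalars R))

/-- `∂(F)`: the supremum of the `t` such that some `f ∈ F^t` is surjective as a map `M → N^t`. -/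
noncomputable def globalCapacity (F : Submodule R (M →ₗ[Sᵐᵒᵖ] N)) : ℕ∞ :=
  ⨆ (t : ℕ) (_ : ∃ f : Fin t → (M →ₗ[Sᵐᵒᵖ] N),
    (∀ i, f i ∈ F) ∧ Function.Surjective (LinearMap.pi f)), (t : ℕ∞)

/-- `∂_p(F)`: the supremum of the `t` such that `f_p` is surjective for some `f ∈ F^t`. -/
noncomputable def localCapacity (F : Submodule R (M →ₗ[Sᵐᵒᵖ] N)) (p : PrimeSpectrum R) : ℕ∞ :=
  ⨆ (t : ℕ) (_ : ∃ f : Fin t → (M →ₗ[Sᵐᵒᵖ] N),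
    (∀ i, f i ∈ F) ∧ SurjectiveAt p f), (t : ℕ∞)

end Capacity

end SurjectiveCapacity

/-! The generators of `F` are discarded one at a time until `t` remain. Write `δ p` for `dim_X(p)`.
While `t + m` generators are left, the invariant is that their span contains `min (t + m) (t + δ p)`
jointly surjective maps at each `p ∈ X`. Discarding one generator costs at most one surjection
(`HasSurj.of_le_sup_span`), so the invariant is in danger only where there is no surjection to
spare. Because `δ` strictly increases when a prime of `X` shrinks within `X`, those primes are
minimal in `X` outside one of finitely many open sets, and Noetherianity leaves only finitely many
of them (`IsBasicSet.finite_minimals`).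

At these finitely many primes an elementary change of generators, made before one is discarded,
avoids the loss (`exists_shear`). A nonmaximal prime has an infinite residue domain, so a polynomial
can be made nonzero there; at a maximal prime linear algebra over the residue field suffices.

At `m = 0` the `t` remaining maps are surjective at every prime of `X` (`exists_tuple_hasSurj`).
Extending them to members of `G` only enlarges their images, and surjectivity at the maximal ideals
in the support gives the global bound. -/

namespace SurjectiveCapacity

/-! ### Surjectivity at a prime, and its stability under perturbation. -/

section Surjectivity

open Polynomial

variable {R M N W W' : Type*} [CommRing R] [AddCommGroup M] [Module R M]
  [AddCommGroup N] [Module R N] [AddCommGroup W] [Module R W] [AddCommGroup W'] [Module R W']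

/-- The linear map `φ` becomes surjective after inverting a single element outside `p`. -/
def SurjAt (p : Ideal R) (φ : M →ₗ[R] W) : Prop :=
  ∃ r ∉ p, ∀ w, ∃ x, φ x = r • w

/-- Some `s` members of `E` form a map `M → N ^ s` that is surjective at `p`. -/
def HasSurj (p : Ideal R) (s : ℕ) (E : Submodule R (M →ₗ[R] N)) : Prop :=
  ∃ h : Fin s → (M →ₗ[R] N), (∀ i, h i ∈ E) ∧ SurjAt p (LinearMap.pi h)

lemma HasSurj.mono {p : Ideal R} {s : ℕ} {E E' : Submodule R (M →ₗ[R] N)} (hE : E ≤ E')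
    (h : HasSurj p s E) : HasSurj p s E' := by
  obtain ⟨h, hh, hs⟩ := h
  exact ⟨h, fun i => hE (hh i), hs⟩

lemma SurjAt.comp {p : Ideal R} [p.IsPrime] {φ : M →ₗ[R] W} {A : W →ₗ[R] W'}
    (hA : SurjAt p A) (hφ : SurjAt p φ) : SurjAt p (A ∘ₗ φ) := by
  obtain ⟨r, hr, h⟩ := hφ
  obtain ⟨q, hq, k⟩ := hA
  refine ⟨r * q, fun hm => (Ideal.IsPrime.mem_or_mem ‹_› hm).elim hr hq, fun w => ?_⟩
  obtain ⟨y, hy⟩ := k w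
  obtain ⟨x, hx⟩ := h y
  exact ⟨x, by simp [hx, hy, mul_smul]⟩

lemma HasSurj.le {p : Ideal R} {s s' : ℕ} {E : Submodule R (M →ₗ[R] N)} (hs : s' ≤ s)
    (h : HasSurj p s E) : HasSurj p s' E := by
  obtain ⟨h, hh, r, hr, k⟩ := h
  refine ⟨fun i => h (Fin.castLE hs i), fun i => hh _, r, hr, fun w => ?_⟩
  obtain ⟨x, hx⟩ := k (fun i => if hi : i.1 < s' then w ⟨i, hi⟩ else 0)
  refine ⟨x, funext fun i => ?_⟩
  simpa using congrFun hx (Fin.castLE hs i)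

/-- Cramer's rule: multiplying by the adjugate puts `A.det • w k` in the image for every `k`. -/
lemma SurjAt.of_det {p : Ideal R} {φ : M →ₗ[R] W} {m : ℕ} {w : Fin m → W}
    (hw : Submodule.span R (Set.range w) = ⊤) (x : Fin m → M) (A : Matrix (Fin m) (Fin m) R)
    (hA : A.det ∉ p) (h : ∀ j, φ (x j) = ∑ l, A j l • w l) : SurjAt p φ := by
  refine ⟨A.det, hA, fun v => ?_⟩
  have hv : v ∈ Submodule.span R (Set.range w) := hw ▸ Submodule.mem_top
  suffices Submodule.span R (Set.range w) ≤
      (LinearMap.range φ).comap (LinearMap.lsmul R W A.det) from this hv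
  rw [Submodule.span_le]
  rintro _ ⟨k, rfl⟩
  refine ⟨∑ j, A.adjugate k j • x j, ?_⟩
  simp only [map_sum, map_smul, h, Finset.smul_sum, smul_smul, LinearMap.lsmul_apply]
  rw [Finset.sum_comm]
  simp only [← Finset.sum_smul, ← Matrix.mul_apply, Matrix.adjugate_mul, Matrix.smul_apply,
    Matrix.one_apply]
  simp

/-- Nakayama's lemma in determinant form: on generators `φ'` acts by a matrix congruent to `r • 1`
modulo `p`, whose determinant is a power of `r` modulo `p`. -/
lemma SurjAt.congr_mod [Module.Finite R W] {p : Ideal R} [p.IsPrime] {φ φ' : M →ₗ[R] W}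
    (hφ : SurjAt p φ) (h : ∀ x, φ' x - φ x ∈ p • (⊤ : Submodule R W)) : SurjAt p φ' := by
  obtain ⟨m, w, hw⟩ := Module.Finite.exists_fin (R := R) (M := W)
  obtain ⟨r, hr, k⟩ := hφ
  choose x hx using fun j => k (w j)
  have hβ : ∀ j, ∃ β : Fin m → R, (∀ l, β l ∈ p) ∧ ∑ l, β l • w l = φ' (x j) - φ (x j) := by
    intro j
    have := h (x j)
    rw [← hw, Submodule.mem_ideal_smul_span_iff_exists_sum] at this
    obtain ⟨a, ha, hs⟩ := this
    refine ⟨a, ha, ?_⟩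
    rw [← hs, Finsupp.sum_fintype _ _ (by simp)]
  choose β hβp hβ using hβ
  refine SurjAt.of_det hw x (r • (1 : Matrix (Fin m) (Fin m) R) + Matrix.of β) ?_ fun j => ?_
  · rw [← Ideal.Quotient.eq_zero_iff_mem, RingHom.map_det]
    have : (Ideal.Quotient.mk p).mapMatrix (r • (1 : Matrix (Fin m) (Fin m) R) + Matrix.of β)
        = (Ideal.Quotient.mk p r) • 1 := by
      ext i j
      have := Ideal.Quotient.eq_zero_iff_mem.2 (hβp i j)
      simp [Matrix.one_apply, this, apply_ite (Ideal.Quotient.mk p)]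
    rw [this, Matrix.det_smul]
    simpa [Ideal.Quotient.eq_zero_iff_mem] using fun h => absurd h hr
  · have : φ' (x j) = r • w j + ∑ l, β j l • w l := by rw [hβ, hx]; abel
    simp [this, add_smul, Finset.sum_add_distrib, Matrix.one_apply, ite_smul]

/-- The polynomial is `det (r + X β)`, where `β` expresses `ψ` on lifts of `r` times the generators;
its value at `0` is a power of `r ∉ p`. -/
lemma SurjAt.exists_polynomial [Module.Finite R W] {p : Ideal R} [p.IsPrime] {φ : M →ₗ[R] W}
    (hφ : SurjAt p φ) (ψ : M →ₗ[R] W) :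
    ∃ d : R[X], d.map (Ideal.Quotient.mk p) ≠ 0 ∧
      ∀ c, d.eval c ∉ p → SurjAt p (φ + c • ψ) := by
  obtain ⟨m, w, hw⟩ := Module.Finite.exists_fin (R := R) (M := W)
  obtain ⟨r, hr, k⟩ := hφ
  choose x hx using fun j => k (w j)
  have hβ : ∀ j, ∃ β : Fin m → R, ∑ l, β l • w l = ψ (x j) := fun j =>
    (Submodule.mem_span_range_iff_exists_fun R).1 (hw ▸ Submodule.mem_top)
  choose β hβ using hβ
  let A : Matrix (Fin m) (Fin m) R[X] := C r • 1 + (X : R[X]) • (Matrix.of β).map C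
  have hA (c : R) : A.det.eval c = (r • (1 : Matrix (Fin m) (Fin m) R) + c • Matrix.of β).det := by
    rw [← Polynomial.coe_evalRingHom, RingHom.map_det]
    congr 1
    ext i j
    simp [A, Matrix.one_apply, apply_ite (Polynomial.eval c)]
    ring
  refine ⟨A.det, fun h0 => ?_, fun c hc => ?_⟩
  · have h1 : (A.det.map (Ideal.Quotient.mk p)).eval (Ideal.Quotient.mk p 0) = 0 := by simp [h0]
    rw [Polynomial.eval_map_apply, hA, zero_smul, add_zero, Matrix.det_smul] at h1
    simp [Ideal.Quotient.eq_zero_iff_mem] at h1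
    exact hr h1.1
  · rw [hA] at hc
    refine SurjAt.of_det hw x _ hc fun j => ?_
    simp [hx, ← hβ, add_smul, Finset.sum_add_distrib, Matrix.one_apply, ite_smul, Finset.smul_sum,
      smul_smul]

lemma exists_eval_affine_notMem {p : Ideal R} [p.IsPrime] (hp : ¬ p.IsMaximal) {d : R[X]}
    (hd : d.map (Ideal.Quotient.mk p) ≠ 0) {x : R} (hx : x ∉ p) (y : R) :
    ∃ z, d.eval (x * z + y) ∉ p := by
  by_contra! h
  have : Infinite (R ⧸ p) := by
    by_contra hfin
    rw [not_infinite_iff_finite] at hfin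
    exact hp (Ideal.Quotient.maximal_of_isField p (Finite.isField_of_domain _))
  refine hd (Polynomial.eq_zero_of_infinite_isRoot _ (Set.Infinite.mono (s := Set.range
    fun z : R ⧸ p => Ideal.Quotient.mk p x * z + Ideal.Quotient.mk p y) ?_
    (Set.infinite_range_of_injective ?_)))
  · rintro _ ⟨z, rfl⟩
    obtain ⟨z, rfl⟩ := Ideal.Quotient.mk_surjective z
    simp only [Set.mem_ofPred_eq, IsRoot.def]
    rw [← map_mul, ← map_add, Polynomial.eval_map_apply, Ideal.Quotient.eq_zero_iff_mem]
    exact h z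
  · intro a b hab
    simpa [Ideal.Quotient.eq_zero_iff_mem, hx] using hab

end Surjectivity
end SurjectiveCapacity

namespace SurjectiveCapacity

/-! ### Discarding one generator at a single prime. -/

section Exchange

open Polynomial Matrix

variable {R M N : Type*} [CommRing R] [AddCommGroup M] [Module R M]
  [AddCommGroup N] [Module R N]

lemma SurjAt.pi_congr_mod [Module.Finite R N] {p : Ideal R} [p.IsPrime] {s : ℕ}
    {h h' : Fin s → (M →ₗ[R] N)} (hs : SurjAt p (LinearMap.pi h))
    (hh : ∀ i x, h' i x - h i x ∈ p • (⊤ : Submodule R N)) : SurjAt p (LinearMap.pi h') := by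
  refine hs.congr_mod fun x => ?_
  rw [← Finset.univ_sum_single (LinearMap.pi h' x - LinearMap.pi h x)]
  refine Submodule.sum_mem _ fun i _ => ?_
  have h1 : (p • (⊤ : Submodule R N)).map (LinearMap.single R (fun _ : Fin s => N) i) ≤
      p • (⊤ : Submodule R (Fin s → N)) := by
    rw [Submodule.map_smul'']
    exact Submodule.smul_mono le_rfl le_top
  exact h1 ⟨_, hh i x, rfl⟩

/-- Passing from `E'` to a submodule of corank one costs at most one surjection. -/
lemma HasSurj.of_le_sup_span [Module.Finite R N] {p : Ideal R} [p.IsPrime] {s : ℕ}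
    {E E' : Submodule R (M →ₗ[R] N)} {g : M →ₗ[R] N} (hE : E ≤ E' ⊔ Submodule.span R {g})
    (h : HasSurj p (s + 1) E) : HasSurj p s E' := by
  obtain ⟨h, hh, hs⟩ := h
  have hl : ∀ i, ∃ l : R, h i - l • g ∈ E' := by
    intro i
    obtain ⟨y, hy, z, hz, e⟩ := Submodule.mem_sup.1 (hE (hh i))
    obtain ⟨l, rfl⟩ := Submodule.mem_span_singleton.1 hz
    exact ⟨l, by rwa [← e, add_sub_cancel_right]⟩
  choose l hl using hl
  by_cases hp : ∀ i, l i ∈ p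
  · refine HasSurj.le (Nat.le_succ s) ⟨fun i => h i - l i • g, hl, hs.pi_congr_mod fun i x => ?_⟩
    have : (h i - l i • g) x - h i x = -(l i • g x) := by simp
    rw [this]
    exact Submodule.neg_mem _ (Submodule.smul_mem_smul (hp i) Submodule.mem_top)
  push Not at hp
  obtain ⟨k, hk⟩ := hp
  -- Elimination with pivot `l k ∉ p`: the coefficients of `g` cancel, at the cost of the map `h k`.
  refine ⟨fun i => l k • h (k.succAbove i) - l (k.succAbove i) • h k, fun i => ?_, ?_⟩
  · have : l k • h (k.succAbove i) - l (k.succAbove i) • h k =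
        l k • (h (k.succAbove i) - l (k.succAbove i) • g) -
          l (k.succAbove i) • (h k - l k • g) := by
      rw [smul_sub, smul_sub, smul_comm (l k) (l (k.succAbove i)) g]; abel
    simp only [this]
    exact E'.sub_mem (E'.smul_mem _ (hl _)) (E'.smul_mem _ (hl _))
  · let A : (Fin (s + 1) → N) →ₗ[R] (Fin s → N) := LinearMap.pi fun i =>
      l k • LinearMap.proj (k.succAbove i) - l (k.succAbove i) • LinearMap.proj k
    have hA : SurjAt p A := by
      refine ⟨l k, hk, fun w => ⟨k.insertNth 0 w, ?_⟩⟩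
      ext i
      simp [A]
    exact hA.comp hs

lemma HasSurj.exists_coeff {p : Ideal R} {s v : ℕ} {f : Fin v → (M →ₗ[R] N)} {g : M →ₗ[R] N}
    (h : HasSurj p s (Submodule.span R (Set.range f) ⊔ Submodule.span R {g})) :
    ∃ (C : Fin s → Fin v → R) (c : Fin s → R),
      SurjAt p (LinearMap.pi fun i => ∑ j, C i j • f j + c i • g) := by
  obtain ⟨h, hh, hs⟩ := h
  have key : ∀ i, ∃ (C : Fin v → R) (c : R), h i = ∑ j, C j • f j + c • g := by
    intro i
    obtain ⟨y, hy, z, hz, e⟩ := Submodule.mem_sup.1 (hh i)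
    obtain ⟨c, rfl⟩ := Submodule.mem_span_singleton.1 hz
    obtain ⟨C, rfl⟩ := (Submodule.mem_span_range_iff_exists_fun R).1 hy
    exact ⟨C, c, e.symm⟩
  choose C c hC using key
  exact ⟨C, c, by rwa [← funext hC]⟩

lemma hasSurj_span_range {p : Ideal R} {s v : ℕ} {f : Fin v → (M →ₗ[R] N)} (C : Fin s → Fin v → R)
    (h : SurjAt p (LinearMap.pi fun i => ∑ j, C i j • f j)) :
    HasSurj p s (Submodule.span R (Set.range f)) :=
  ⟨_, fun _ => Submodule.sum_mem _ fun j _ => Submodule.smul_mem _ _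
    (Submodule.subset_span ⟨j, rfl⟩), h⟩

/-- At a nonmaximal prime, the coefficient vector `a` can be moved within a coset of an ideal. -/
lemma exists_coeff_of_not_isMaximal [Module.Finite R N] {p : Ideal R} [p.IsPrime]
    (hp : ¬ p.IsMaximal) {s v : ℕ} (hsv : s ≤ v) {f : Fin v → (M →ₗ[R] N)} {g : M →ₗ[R] N}
    (h : HasSurj p s (Submodule.span R (Set.range f) ⊔ Submodule.span R {g}))
    {I : Ideal R} (hI : ¬ I ≤ p) :
    ∃ a : Fin v → R, (∀ j, a j ∈ I) ∧
      HasSurj p s (Submodule.span R (Set.range fun j => f j + a j • g)) := by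
  obtain ⟨C, c, hC⟩ := h.exists_coeff
  obtain ⟨d₁, hd₁, H₁⟩ := hC.exists_polynomial
    (LinearMap.pi fun i : Fin s => f (Fin.castLE hsv i))
  -- Adding `z` to the diagonal of this leading block makes it invertible at `p` once `z` avoids the
  -- roots of the characteristic polynomial of `-A` modulo `p`.
  let A : Matrix (Fin s) (Fin s) R := Matrix.of fun i j => C i (Fin.castLE hsv j)
  have hd₂ : ((-A).charpoly).map (Ideal.Quotient.mk p) ≠ 0 :=
    ((-A).charpoly_monic.map _).ne_zero
  obtain ⟨z, hz⟩ := exists_eval_affine_notMem hp (d := d₁ * (-A).charpoly)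
    (by rw [Polynomial.map_mul]; exact mul_ne_zero hd₁ hd₂) (x := 1)
    (fun h => Ideal.IsPrime.ne_top ‹_› ((Ideal.eq_top_iff_one _).2 h)) 0
  rw [one_mul, add_zero, Polynomial.eval_mul] at hz
  have hz₁ := fun h => hz (Ideal.mul_mem_right _ _ h)
  have hz₂ := fun h => hz (Ideal.mul_mem_left _ _ h)
  rw [Matrix.eval_charpoly, sub_neg_eq_add] at hz₂
  have hS := H₁ z hz₁
  let A' : Matrix (Fin s) (Fin s) R := Matrix.scalar _ z + A
  let C' : Fin s → Fin v → R := fun i j => C i j + if j = Fin.castLE hsv i then z else 0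
  have hA' (i j : Fin s) : C' i (Fin.castLE hsv j) = A' i j := by
    simp [C', A', A, Matrix.scalar_apply, Matrix.diagonal_apply, add_comm, eq_comm]
  have hC' : SurjAt p (LinearMap.pi fun i => ∑ j, C' i j • f j + c i • g) := by
    convert hS using 1
    ext x i
    simp [C', add_smul, Finset.sum_add_distrib, ite_smul]
    abel
  -- Cramer's solution of `C' b = A'.det • c`, supported on the first `s` coordinates.
  let b : Fin v → R := fun j => if h : j.1 < s then (A'.adjugate *ᵥ c) ⟨j, h⟩ else 0
  have hb (i : Fin s) : ∑ j, C' i j * b j = A'.det * c i := by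
    have e : ∑ j, C' i j * b j = ∑ k : Fin s, C' i (Fin.castLE hsv k) * b (Fin.castLE hsv k) := by
      symm
      rw [← Finset.sum_image (s := Finset.univ) (g := Fin.castLE hsv)
        (f := fun j => C' i j * b j) (by simp [Set.InjOn])]
      refine Finset.sum_subset (Finset.subset_univ _) fun j _ hj => ?_
      have : ¬ j.1 < s := fun hjs => hj (Finset.mem_image.2 ⟨⟨j, hjs⟩, Finset.mem_univ _, rfl⟩)
      simp [b, this]
    have : (A' *ᵥ (A'.adjugate *ᵥ c)) i = A'.det * c i := by
      rw [Matrix.mulVec_mulVec, Matrix.mul_adjugate, Matrix.smul_mulVec, Matrix.one_mulVec]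
      rfl
    rw [e, ← this]
    simp [hA', b, Matrix.mulVec, dotProduct]
  obtain ⟨i₀, hi₀, hi₀p⟩ := Set.not_subset.1 hI
  have hdS : SurjAt p (A'.det • LinearMap.pi fun i => ∑ j, C' i j • f j + c i • g) := by
    obtain ⟨r, hr, k⟩ := hC'
    refine ⟨A'.det * r, fun hm => (Ideal.IsPrime.mem_or_mem ‹_› hm).elim hz₂ hr, fun w => ?_⟩
    obtain ⟨x, hx⟩ := k w
    exact ⟨x, by rw [LinearMap.smul_apply, hx, smul_smul]⟩
  obtain ⟨d₃, hd₃, H₃⟩ := hdS.exists_polynomial (LinearMap.pi fun i => (A'.det * c i) • g)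
  -- The offset `-1` removes the original multiple of `g`; the rest, `A'.det * i₀ * y` times `A'.det
  -- * c i`, is what the coefficients `i₀ * y * b j`, all in `I`, contribute.
  obtain ⟨y, hy⟩ := exists_eval_affine_notMem hp hd₃ (x := A'.det * i₀)
    (fun hm => (Ideal.IsPrime.mem_or_mem ‹_› hm).elim hz₂ hi₀p) (-1)
  refine ⟨fun j => i₀ * y * b j, fun j => Ideal.mul_mem_right _ _ (Ideal.mul_mem_right _ _ hi₀),
    hasSurj_span_range (fun i j => A'.det * C' i j) ?_⟩
  convert H₃ _ hy using 1
  ext x i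
  have e : ∑ j, (A'.det * C' i j) * (i₀ * y * b j) = A'.det * (i₀ * y) * (A'.det * c i) := by
    rw [← hb, Finset.mul_sum]
    exact Finset.sum_congr rfl fun j _ => by ring
  simp only [LinearMap.pi_apply, LinearMap.sum_apply, LinearMap.smul_apply, LinearMap.add_apply,
    smul_add, smul_smul, Finset.sum_add_distrib, ← Finset.sum_smul, e, Pi.add_apply, Pi.smul_apply,
    Finset.smul_sum]
  rw [add_assoc, ← add_smul]
  congr 2
  ring

/-- At a maximal prime, some pair of coefficient vectors works. -/
lemma exists_coeff_of_isMaximal [Module.Finite R N] {p : Ideal R} (hp : p.IsMaximal)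
    {s v : ℕ} (hsv : s ≤ v) {f : Fin v → (M →ₗ[R] N)} {g : M →ₗ[R] N}
    (h : HasSurj p s (Submodule.span R (Set.range f) ⊔ Submodule.span R {g})) :
    ∃ a b : Fin v → R,
      HasSurj p s (Submodule.span R (Set.range fun j => f j + a j • (g + ∑ k, b k • f k))) := by
  obtain ⟨C, c, hC⟩ := h.exists_coeff
  let := Ideal.Quotient.field p
  let π := Ideal.Quotient.mk p
  let T : ((Fin v → R ⧸ p) × (R ⧸ p)) →ₗ[R ⧸ p] (Fin s → R ⧸ p) :=
    LinearMap.pi fun i => (∑ j, π (C i j) • LinearMap.proj j).coprod (π (c i) • LinearMap.id)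
  -- As `s < v + 1`, some nonzero vector is killed by all coefficient rows. The choice of `b` makes
  -- its pairing `w` with `g + ∑ k, b k • f k` nonzero, and `a = -h' / w` makes every sheared
  -- generator annihilate it; modulo `p` these generators then span the hyperplane containing the
  -- rows.
  obtain ⟨⟨h', u'⟩, hker, hne⟩ := Submodule.exists_mem_ne_zero_of_ne_bot
    (LinearMap.ker_ne_bot_of_finrank_lt (f := T) (by simp; omega))
  have hb : ∃ b' : Fin v → R ⧸ p, u' + ∑ k, b' k * h' k ≠ 0 := by
    by_cases hu : u' = 0
    · have : h' ≠ 0 := fun h0 => hne (by rw [hu, h0]; rfl)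
      obtain ⟨k, hk⟩ := Function.ne_iff.1 this
      exact ⟨Pi.single k 1, by simpa [hu, Pi.single_apply] using hk⟩
    · exact ⟨0, by simpa using hu⟩
  obtain ⟨b', hb'⟩ := hb
  set w := u' + ∑ k, b' k * h' k
  obtain ⟨b, hb⟩ := Function.Surjective.comp_left (α := Fin v) (Ideal.Quotient.mk_surjective (I := p)) b'
  obtain ⟨a, ha⟩ := Function.Surjective.comp_left (α := Fin v) (Ideal.Quotient.mk_surjective (I := p)) (fun j => - (h' j / w))
  refine ⟨a, b, hasSurj_span_range (fun i j => C i j - c i * b j) (hC.pi_congr_mod fun i x => ?_)⟩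
  have hT : ∑ j, π (C i j) * h' j + π (c i) * u' = 0 := by
    simpa [T] using congrFun (LinearMap.mem_ker.1 hker) i
  have hmem : ∑ j, (C i j - c i * b j) * a j - c i ∈ p := by
    rw [← Ideal.Quotient.eq_zero_iff_mem]
    have ha' (j) : Ideal.Quotient.mk p (a j) = -(h' j / w) := congrFun ha j
    have hb'' (j) : Ideal.Quotient.mk p (b j) = b' j := congrFun hb j
    simp only [map_sub, map_sum, map_mul, ha', hb'']
    have e : ∑ j, (Ideal.Quotient.mk p (C i j) - Ideal.Quotient.mk p (c i) * b' j) * -(h' j / w)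
        = -((∑ j, π (C i j) * h' j) - π (c i) * ∑ k, b' k * h' k) / w := by
      rw [Finset.mul_sum, ← Finset.sum_sub_distrib, ← Finset.sum_neg_distrib, Finset.sum_div]
      exact Finset.sum_congr rfl fun j _ => by ring
    rw [e, eq_neg_of_add_eq_zero_left hT]
    have : -(-(π (c i) * u') - π (c i) * ∑ k, b' k * h' k) = π (c i) * w := by ring
    rw [this, mul_div_cancel_right₀ _ hb', sub_self]
  have : (∑ j, (C i j - c i * b j) • (f j + a j • (g + ∑ k, b k • f k))) x -
      (∑ j, C i j • f j + c i • g) x =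
      (∑ j, (C i j - c i * b j) * a j - c i) • (g + ∑ k, b k • f k) x := by
    have e : ∑ j, (C i j - c i * b j) • f j = ∑ j, C i j • f j - c i • ∑ k, b k • f k := by
      rw [Finset.smul_sum, ← Finset.sum_sub_distrib]
      exact Finset.sum_congr rfl fun j _ => by rw [sub_smul, mul_smul]
    simp_rw [smul_add (_ - _) (f _), smul_smul, Finset.sum_add_distrib, ← Finset.sum_smul, e,
      ← LinearMap.sub_apply, ← LinearMap.smul_apply]
    congr 1
    module
  rw [this]
  exact Submodule.smul_mem_smul hmem Submodule.mem_top

end Exchange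
end SurjectiveCapacity

namespace SurjectiveCapacity

/-! ### Simultaneous exchange at finitely many primes, and the induction. -/

section Descent

variable {R M N : Type*} [CommRing R] [AddCommGroup M] [Module R M]
  [AddCommGroup N] [Module R N]

lemma HasSurj.span_congr_mod [Module.Finite R N] {p : Ideal R} [p.IsPrime] {s v : ℕ}
    {f f' : Fin v → (M →ₗ[R] N)} (hff : ∀ j x, f' j x - f j x ∈ p • (⊤ : Submodule R N))
    (h : HasSurj p s (Submodule.span R (Set.range f))) :
    HasSurj p s (Submodule.span R (Set.range f')) := by
  obtain ⟨h, hh, hs⟩ := h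
  choose C hC using fun i => (Submodule.mem_span_range_iff_exists_fun R).1 (hh i)
  refine hasSurj_span_range C (hs.pi_congr_mod fun i x => ?_)
  rw [← hC, ← LinearMap.sub_apply, ← Finset.sum_sub_distrib, LinearMap.sum_apply]
  refine Submodule.sum_mem _ fun j _ => ?_
  rw [← smul_sub]
  exact Submodule.smul_mem _ _ (hff j x)

/-- The family obtained from `f` and `g` by the elementary operations with coefficients `b`
and `a`. -/
def shear {v : ℕ} (f : Fin v → (M →ₗ[R] N)) (g : M →ₗ[R] N) (a b : Fin v → R) :
    Fin v → (M →ₗ[R] N) :=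
  fun j => f j + a j • (g + ∑ k, b k • f k)

lemma HasSurj.shear_congr_mod [Module.Finite R N] {p : Ideal R} [p.IsPrime] {s v : ℕ}
    {f : Fin v → (M →ₗ[R] N)} {g : M →ₗ[R] N} {a b a' b' : Fin v → R}
    (ha : ∀ j, a' j - a j ∈ p) (hb : ∀ j, b' j - b j ∈ p)
    (h : HasSurj p s (Submodule.span R (Set.range (shear f g a b)))) :
    HasSurj p s (Submodule.span R (Set.range (shear f g a' b'))) := by
  refine h.span_congr_mod fun j x => ?_
  have e : shear f g a' b' j x - shear f g a b j x =
      (a' j - a j) • (g + ∑ k, b' k • f k) x + a j • ∑ k, (b' k - b k) • f k x := by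
    simp only [shear, LinearMap.add_apply, LinearMap.smul_apply, LinearMap.sum_apply, sub_smul,
      Finset.sum_sub_distrib]
    module
  rw [e]
  exact Submodule.add_mem _ (Submodule.smul_mem_smul (ha j) Submodule.mem_top)
    (Submodule.smul_mem _ _ (Submodule.sum_mem _ fun k _ =>
      Submodule.smul_mem_smul (hb k) Submodule.mem_top))

/-- Elementary operations are invertible, so the sheared family misses the original span by one
generator only. -/
lemma span_le_span_shear {v : ℕ} (f : Fin v → (M →ₗ[R] N)) (g : M →ₗ[R] N) (a b : Fin v → R) :
    Submodule.span R (Set.range f) ⊔ Submodule.span R {g} ≤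
      Submodule.span R (Set.range (shear f g a b)) ⊔
        Submodule.span R {g + ∑ k, b k • f k} := by
  set E := Submodule.span R (Set.range (shear f g a b)) ⊔ Submodule.span R {g + ∑ k, b k • f k}
  have hg' : g + ∑ k, b k • f k ∈ E :=
    le_sup_right (a := Submodule.span R (Set.range (shear f g a b)))
      (Submodule.mem_span_singleton_self _)
  have hf (j) : f j ∈ E := by
    have h1 : shear f g a b j ∈ E :=
      le_sup_left (b := Submodule.span R {g + ∑ k, b k • f k})
        (Submodule.subset_span ⟨j, rfl⟩)
    have := E.sub_mem h1 (E.smul_mem (a j) hg')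
    simpa [shear] using this
  refine sup_le (Submodule.span_le.2 ?_) (Submodule.span_le.2 ?_)
  · rintro _ ⟨j, rfl⟩
    exact hf j
  · rintro _ rfl
    have := E.sub_mem hg' (E.sum_mem (t := Finset.univ) fun k _ => E.smul_mem (b k) (hf k))
    simpa using this

/-- One choice of elementary operations works simultaneously for finitely many primes. -/
lemma exists_shear [Module.Finite R N] {v : ℕ} (f : Fin v → (M →ₗ[R] N)) (g : M →ₗ[R] N)
    (s : PrimeSpectrum R → ℕ) (P : Finset (PrimeSpectrum R)) (hsv : ∀ p ∈ P, s p ≤ v)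
    (h : ∀ p ∈ P, HasSurj p.asIdeal (s p)
      (Submodule.span R (Set.range f) ⊔ Submodule.span R {g})) :
    ∃ a b : Fin v → R, ∀ p ∈ P,
      HasSurj p.asIdeal (s p) (Submodule.span R (Set.range (shear f g a b))) := by
  classical
  induction P using Finset.strongInduction with
  | H P ih =>
  rcases P.eq_empty_or_nonempty with rfl | hne
  · exact ⟨0, 0, by simp⟩
  obtain ⟨p, hp⟩ := P.exists_minimal hne
  have hpP := hp.prop
  obtain ⟨a₀, b₀, h₀⟩ := ih (P.erase p) (Finset.erase_ssubset hpP)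
    (fun q hq => hsv q (Finset.mem_of_mem_erase hq)) (fun q hq => h q (Finset.mem_of_mem_erase hq))
  -- Changing `a` and `b` by elements of `I` preserves what holds at the other primes; minimality of
  -- `p` keeps `I` out of `p`, leaving room to adjust there.
  let I : Ideal R := (P.erase p).inf PrimeSpectrum.asIdeal
  have hIq : ∀ q ∈ P.erase p, I ≤ q.asIdeal := fun q hq => Finset.inf_le hq
  have hI : ¬ I ≤ p.asIdeal := by
    intro hle
    obtain ⟨q, hq, hqp⟩ := (Ideal.IsPrime.inf_le' p.isPrime).1 hle
    exact (Finset.mem_erase.1 hq).1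
      (le_antisymm hqp (hp.le_of_le (Finset.mem_of_mem_erase hq) hqp))
  suffices ∃ a b : Fin v → R, (∀ j, a j - a₀ j ∈ I) ∧ (∀ j, b j - b₀ j ∈ I) ∧
      HasSurj p.asIdeal (s p) (Submodule.span R (Set.range (shear f g a b))) by
    obtain ⟨a, b, ha, hb, hab⟩ := this
    refine ⟨a, b, fun q hq => ?_⟩
    by_cases hqp : q = p
    · rwa [hqp]
    · have hq' := Finset.mem_erase.2 ⟨hqp, hq⟩
      exact (h₀ q hq').shear_congr_mod (fun j => hIq q hq' (ha j)) (fun j => hIq q hq' (hb j))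
  by_cases hmax : p.asIdeal.IsMaximal
  · obtain ⟨a, b, hab⟩ := exists_coeff_of_isMaximal hmax (hsv p hpP) (h p hpP)
    obtain ⟨e, he, e', he', hee⟩ := Submodule.mem_sup.1 ((Ideal.eq_top_iff_one _).1
      -- Chinese remaindering: `e ∈ I` is congruent to `1` modulo `p`.
      (hmax.out.2 _ (right_lt_sup.2 hI)))
    have key (x y : R) : y + e * (x - y) - x ∈ p.asIdeal := by
      have : y + e * (x - y) - x = e' * (y - x) := by linear_combination (x - y) * hee
      rw [this]
      exact Ideal.mul_mem_right _ _ he'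
    refine ⟨fun j => a₀ j + e * (a j - a₀ j), fun j => b₀ j + e * (b j - b₀ j), fun j => ?_,
      fun j => ?_, HasSurj.shear_congr_mod (a := a) (b := b) (fun j => key _ _)
        (fun j => key _ _) hab⟩
    · simpa using Ideal.mul_mem_right _ _ he
    · simpa using Ideal.mul_mem_right _ _ he
  · obtain ⟨a, ha, hs⟩ := exists_coeff_of_not_isMaximal hmax (hsv p hpP)
      ((h p hpP).mono (span_le_span_shear f g a₀ b₀)) hI
    refine ⟨fun j => a₀ j + a j, b₀, fun j => by simpa using ha j, fun j => by simp, ?_⟩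
    convert hs using 4
    ext j : 1
    simp only [shear, add_smul, add_assoc]

lemma isOpen_setOf_hasSurj (s : ℕ) (E : Submodule R (M →ₗ[R] N)) :
    IsOpen {p : PrimeSpectrum R | HasSurj p.asIdeal s E} := by
  rw [isOpen_iff_forall_mem_open]
  rintro p ⟨h, hh, r, hr, k⟩
  exact ⟨PrimeSpectrum.basicOpen r, fun q hq => ⟨h, hh, r, hq, k⟩,
    (PrimeSpectrum.basicOpen r).2, hr⟩

/-- The generic point is the vanishing ideal of `Z`: prime by irreducibility, and in `X` as an
intersection of members of `X`. -/
lemma IsBasicSet.exists_generic {X : Set (PrimeSpectrum R)} (hX : IsBasicSet X)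
    {Z : Set X} (hZ : IsIrreducible Z) (hZc : IsClosed Z) :
    ∃ p ∈ Z, ∀ q ∈ Z, p ≤ q := by
  have hirr : IsIrreducible (Subtype.val '' Z) := hZ.image _ continuous_subtype_val.continuousOn
  have hprime := PrimeSpectrum.isIrreducible_iff_vanishingIdeal_isPrime.1 hirr
  let p : PrimeSpectrum R := ⟨_, hprime⟩
  have hpX : p ∈ X := hX.2 p (Subtype.val '' Z) (by rintro _ ⟨x, _, rfl⟩; exact x.2) rfl
  have hle : ∀ q ∈ Z, p ≤ q.1 := fun q hq =>
    iInf₂_le (f := fun (x : PrimeSpectrum R) (_ : x ∈ Subtype.val '' Z) => x.asIdeal) q.1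
      ⟨q, hq, rfl⟩
  refine ⟨⟨p, hpX⟩, ?_, fun q hq => hle q hq⟩
  obtain ⟨Y, hY, rfl⟩ := isClosed_induced_iff.1 hZc
  obtain ⟨I, rfl⟩ := (PrimeSpectrum.isClosed_iff_zeroLocus_ideal Y).1 hY
  rw [Set.mem_preimage, PrimeSpectrum.mem_zeroLocus]
  refine (PrimeSpectrum.subset_zeroLocus_iff_le_vanishingIdeal _ I).1 ?_
  rintro _ ⟨q, hq, rfl⟩
  exact hq

lemma IsBasicSet.finite_minimals {X : Set (PrimeSpectrum R)} (hX : IsBasicSet X)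
    {U : Set (PrimeSpectrum R)} (hU : IsOpen U) :
    {p | p ∈ X ∧ p ∉ U ∧ ∀ q ∈ X, q < p → q ∈ U}.Finite := by
  rcases X.eq_empty_or_nonempty with rfl | hne
  · simp
  have := hne.to_subtype
  have := hX.1
  obtain ⟨S, hSf, hSc, hSi, hS⟩ := TopologicalSpace.NoetherianSpace.exists_finite_set_isClosed_irreducible
    (hU.isClosed_compl.preimage (continuous_subtype_val (p := (· ∈ X))))
  choose! η hη hηle using fun Z hZ => hX.exists_generic (hSi Z hZ) (hSc Z hZ)
  refine (hSf.image fun Z => (η Z).1).subset ?_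
  rintro p ⟨hpX, hpU, hmin⟩
  have hp : (⟨p, hpX⟩ : X) ∈ ⋃₀ S := hS ▸ hpU
  obtain ⟨Z, hZ, hpZ⟩ := hp
  refine ⟨Z, hZ, ?_⟩
  by_contra hne
  have hZU : (η Z).1 ∉ U := by
    have : η Z ∈ ⋃₀ S := ⟨Z, hZ, hη Z hZ⟩
    rw [← hS] at this
    exact this
  exact hZU (hmin _ (η Z).2 (lt_of_le_of_ne (hηle Z hZ _ hpZ) hne))

/-- The generators of a module of homomorphisms can be reduced to `t` of them, as long as the local
capacities exceed `t` by a strictly decreasing function on `X`. -/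
theorem exists_tuple_hasSurj [Module.Finite R N] {X : Set (PrimeSpectrum R)} (hX : IsBasicSet X)
    (δ : PrimeSpectrum R → ℕ) (hδ : ∀ p ∈ X, ∀ q ∈ X, q < p → δ p < δ q) (t m : ℕ)
    (f : Fin (t + m) → (M →ₗ[R] N))
    (hf : ∀ p ∈ X, HasSurj p.asIdeal (min (t + m) (t + δ p)) (Submodule.span R (Set.range f))) :
    ∃ g : Fin t → (M →ₗ[R] N), (∀ i, g i ∈ Submodule.span R (Set.range f)) ∧
      ∀ p ∈ X, HasSurj p.asIdeal t (Submodule.span R (Set.range g)) := by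
  induction m with
  | zero =>
    exact ⟨f, fun i => Submodule.subset_span ⟨i, rfl⟩, fun p hp => by simpa using hf p hp⟩
  | succ m ih =>
  let f₀ : Fin (t + m) → (M →ₗ[R] N) := fun j => f j.castSucc
  let g₀ : M →ₗ[R] N := f (Fin.last _)
  set E := Submodule.span R (Set.range f)
  have hfE (j) : f j ∈ E := Submodule.subset_span ⟨j, rfl⟩
  have hE : E ≤ Submodule.span R (Set.range f₀) ⊔ Submodule.span R {g₀} := by
    refine Submodule.span_le.2 ?_
    rintro _ ⟨j, rfl⟩
    induction j using Fin.lastCases with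
    | last => exact Submodule.mem_sup_right (Submodule.mem_span_singleton_self _)
    | cast j => exact Submodule.mem_sup_left (Submodule.subset_span ⟨j, rfl⟩)
  -- The primes with no surjection to spare. If `δ p > m`, the target drops from `t + m + 1` to `t +
  -- m`, so a loss is harmless.
  let B : Set (PrimeSpectrum R) := {p | p ∈ X ∧ δ p ≤ m ∧ ¬ HasSurj p.asIdeal (t + δ p + 1) E}
  have hB : B.Finite := by
    refine ((Set.finite_Iic m).biUnion fun d _ =>
      hX.finite_minimals (isOpen_setOf_hasSurj (t + d + 1) E)).subset ?_
    rintro p ⟨hpX, hpm, hp⟩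
    refine Set.mem_biUnion (x := δ p) hpm ⟨hpX, hp, fun q hq hqp => ?_⟩
    have := hδ p hpX q hq hqp
    exact (hf q hq).le (by omega)
  obtain ⟨a, b, hab⟩ := exists_shear f₀ g₀ (fun p => t + δ p) hB.toFinset
    (fun p hp => by have := (hB.mem_toFinset.1 hp).2.1; omega)
    (fun p hp => by
      obtain ⟨hpX, hpm, -⟩ := hB.mem_toFinset.1 hp
      exact ((hf p hpX).le (by omega)).mono hE)
  obtain ⟨g, hg, hs⟩ := ih (shear f₀ g₀ a b) fun p hpX => by
    by_cases hpB : p ∈ B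
    · exact (hab p (hB.mem_toFinset.2 hpB)).le (min_le_right _ _)
    · have hE' := hE.trans (span_le_span_shear f₀ g₀ a b)
      by_cases hpm : δ p ≤ m
      · have : HasSurj p.asIdeal (t + δ p + 1) E := by
          by_contra hn
          exact hpB ⟨hpX, hpm, hn⟩
        exact (this.of_le_sup_span hE').le (min_le_right _ _)
      · exact (((hf p hpX).le (s' := t + m + 1) (by omega)).of_le_sup_span hE').le
          (min_le_left _ _)
  refine ⟨g, fun i => ?_, hs⟩
  refine Submodule.span_le.2 ?_ (hg i)
  rintro _ ⟨j, rfl⟩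
  exact E.add_mem (hfE _) (E.smul_mem _ (E.add_mem (hfE _)
    (E.sum_mem fun k _ => E.smul_mem _ (hfE _))))

end Descent
end SurjectiveCapacity

namespace SurjectiveCapacity

/-! ### Strict monotonicity of `dim_X`. -/

section Dimension

open TopologicalSpace Topology

variable {R : Type*} [CommRing R]

lemma isIrreducible_univ_zeroLocus_inter {X : Set (PrimeSpectrum R)} {q : PrimeSpectrum R}
    (hq : q ∈ X) :
    IsIrreducible (Set.univ : Set ↥(PrimeSpectrum.zeroLocus (q.asIdeal : Set R) ∩ X)) := by
  let x : ↥(PrimeSpectrum.zeroLocus (q.asIdeal : Set R) ∩ X) := ⟨q, fun _ h => h, hq⟩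
  have : closure {x} = Set.univ := Set.eq_univ_of_forall fun y => by
    rw [closure_subtype, Set.image_singleton,
      ← specializes_iff_mem_closure, ← PrimeSpectrum.le_iff_specializes]
    exact y.2.1
  exact this ▸ isIrreducible_singleton.closure

lemma dimAt_add_one_le {X : Set (PrimeSpectrum R)} {p q : PrimeSpectrum R} (hp : p ∈ X)
    (hq : q ∈ X) (hqp : q < p) : dimAt X p + 1 ≤ dimAt X q := by
  have hsub : PrimeSpectrum.zeroLocus (p.asIdeal : Set R) ∩ X ⊆
      PrimeSpectrum.zeroLocus (q.asIdeal : Set R) ∩ X :=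
    Set.inter_subset_inter_left _ (PrimeSpectrum.zeroLocus_anti_mono hqp.le)
  have : Nonempty (IrreducibleCloseds ↥(PrimeSpectrum.zeroLocus (p.asIdeal : Set R) ∩ X)) :=
    ⟨⟨Set.univ, isIrreducible_univ_zeroLocus_inter hp, isClosed_univ⟩⟩
  have hind := (IsEmbedding.inclusion hsub).isInducing
  let T : IrreducibleCloseds ↥(PrimeSpectrum.zeroLocus (q.asIdeal : Set R) ∩ X) :=
    ⟨Set.univ, isIrreducible_univ_zeroLocus_inter hq, isClosed_univ⟩
  unfold dimAt topologicalKrullDim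
  -- The extra `1` comes from adjoining the whole space `V(q) ∩ X` above every closure of an
  -- irreducible closed subset of `V(p) ∩ X`; it is strictly larger since it contains `q`.
  rw [← Order.krullDim_WithTop]
  refine Order.krullDim_le_of_strictMono
    (fun Z => WithTop.recTopCoe T (IrreducibleCloseds.map _ hind.continuous) Z) ?_
  rw [WithTop.strictMono_iff]
  refine ⟨IrreducibleCloseds.map_strictMono_of_isInducing hind, fun Z => ?_⟩
  refine lt_of_le_of_ne (fun _ _ => Set.mem_univ _) fun h => ?_
  have hc : IsClosed {x : ↥(PrimeSpectrum.zeroLocus (q.asIdeal : Set R) ∩ X) | p ≤ x.1} :=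
    (PrimeSpectrum.isClosed_zeroLocus (p.asIdeal : Set R)).preimage continuous_subtype_val
  have hle : ∀ x ∈ IrreducibleCloseds.map _ hind.continuous Z, p ≤ x.1 := by
    refine closure_minimal ?_ hc
    rintro _ ⟨y, _, rfl⟩
    exact y.2.1
  have hm : (⟨q, fun _ h => h, hq⟩ : ↥(PrimeSpectrum.zeroLocus (q.asIdeal : Set R) ∩ X)) ∈
      IrreducibleCloseds.map _ hind.continuous Z := by
    have h' : IrreducibleCloseds.map _ hind.continuous Z = T := h
    rw [h']
    exact Set.mem_univ _
  exact absurd (hle _ hm) (not_le_of_gt hqp)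

lemma exists_dimAt_eq {X : Set (PrimeSpectrum R)} (hdim : topologicalKrullDim ↥X < ⊤)
    {p : PrimeSpectrum R} (hp : p ∈ X) : ∃ n : ℕ, dimAt X p = n := by
  have h1 : dimAt X p < ⊤ := lt_of_le_of_lt
    (IsEmbedding.inclusion Set.inter_subset_right).isInducing.topologicalKrullDim_le hdim
  have : Nonempty (IrreducibleCloseds ↥(PrimeSpectrum.zeroLocus (p.asIdeal : Set R) ∩ X)) :=
    ⟨⟨Set.univ, isIrreducible_univ_zeroLocus_inter hp, isClosed_univ⟩⟩
  have h2 : 0 ≤ dimAt X p := Order.krullDim_nonneg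
  generalize dimAt X p = d at h1 h2
  induction d with
  | bot => simp at h2
  | coe d =>
    induction d with
    | top => exact absurd h1 (lt_irrefl _)
    | coe n => exact ⟨n, rfl⟩

end Dimension

/-! ### Translation to localizations and capacities. -/

section Capacity

variable {R S M N : Type*} [CommRing R] [Ring S] [Algebra R S]
  [AddCommGroup M] [Module R M] [Module Sᵐᵒᵖ M] [IsScalarTower R Sᵐᵒᵖ M]
  [AddCommGroup N] [Module R N] [Module Sᵐᵒᵖ N] [IsScalarTower R Sᵐᵒᵖ N]

lemma surjAt_iff_localizedModule_map [Module.Finite R N] (p : PrimeSpectrum R)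
    {P : Type*} [AddCommGroup P] [Module R P] (φ : P →ₗ[R] N) :
    SurjAt p.asIdeal φ ↔
      Function.Surjective (LocalizedModule.map p.asIdeal.primeCompl φ) := by
  constructor
  · rintro ⟨r, hr, k⟩ y
    induction y using LocalizedModule.induction_on with
    | h w s =>
    obtain ⟨x, hx⟩ := k w
    refine ⟨LocalizedModule.mk x (⟨r, hr⟩ * s), ?_⟩
    rw [LocalizedModule.map_mk, hx]
    exact LocalizedModule.mk_cancel_common_left ⟨r, hr⟩ s w
  · intro h
    have hex (w : N) : ∃ r ∉ p.asIdeal, ∃ x, φ x = r • w := by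
      obtain ⟨y, hy⟩ := h (LocalizedModule.mk w 1)
      induction y using LocalizedModule.induction_on with
      | h x s =>
      rw [LocalizedModule.map_mk, LocalizedModule.mk_eq] at hy
      obtain ⟨u, hu⟩ := hy
      refine ⟨u.1 * s.1, (u * s).2, u.1 • x, ?_⟩
      simpa [Submonoid.smul_def, mul_smul] using hu
    obtain ⟨m, w, hw⟩ := Module.Finite.exists_fin (R := R) (M := N)
    choose r hr x hx using fun j => hex (w j)
    refine ⟨∏ j, r j, fun hm => ?_, fun v => ?_⟩
    · obtain ⟨j, -, hj⟩ := (Ideal.IsPrime.prod_mem_iff).1 hm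
      exact hr j hj
    · have hv : v ∈ Submodule.span R (Set.range w) := hw ▸ Submodule.mem_top
      suffices Submodule.span R (Set.range w) ≤
          (LinearMap.range φ).comap (LinearMap.lsmul R N (∏ j, r j)) from this hv
      rw [Submodule.span_le]
      rintro _ ⟨j, rfl⟩
      refine ⟨(∏ i ∈ Finset.univ.erase j, r i) • x j, ?_⟩
      rw [map_smul, hx, smul_smul, Finset.prod_erase_mul _ _ (Finset.mem_univ j)]
      rfl

/-- If the span of `t` homomorphisms contains `t` homomorphisms that are jointly surjective at `p`,
then the spanning ones are jointly surjective at `p`. -/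
lemma surjAt_of_hasSurj_span {P : Type*} [AddCommGroup P] [Module R P] [Module.Finite R N]
    (p : PrimeSpectrum R) {t : ℕ} {g : Fin t → (P →ₗ[R] N)}
    (h : HasSurj p.asIdeal t (Submodule.span R (Set.range g))) :
    SurjAt p.asIdeal (LinearMap.pi g) := by
  obtain ⟨h, hh, hs⟩ := h
  choose C hC using fun i => (Submodule.mem_span_range_iff_exists_fun R).1 (hh i)
  let A : (Fin t → N) →ₗ[R] (Fin t → N) := LinearMap.pi fun i => ∑ j, C i j • LinearMap.proj j
  have hA : A ∘ₗ LinearMap.pi g = LinearMap.pi h := by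
    ext x i
    simp [A, ← hC]
  rw [← hA, surjAt_iff_localizedModule_map] at hs
  rw [surjAt_iff_localizedModule_map]
  have hcomp (y) : LocalizedModule.map p.asIdeal.primeCompl (A ∘ₗ LinearMap.pi g) y =
      LocalizedModule.map p.asIdeal.primeCompl A
        (LocalizedModule.map p.asIdeal.primeCompl (LinearMap.pi g) y) := by
    induction y using LocalizedModule.induction_on with
    | h x s => simp [LocalizedModule.map_mk]
  have hAs : Function.Surjective (LocalizedModule.map p.asIdeal.primeCompl A) := fun y => by
    obtain ⟨z, hz⟩ := hs y
    exact ⟨_, (hcomp z).symm.trans hz⟩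
  have hfin : Module.Finite (Localization p.asIdeal.primeCompl)
      (LocalizedModule p.asIdeal.primeCompl (Fin t → N)) :=
    Module.Finite.of_isLocalizedModule p.asIdeal.primeCompl
      (LocalizedModule.mkLinearMap p.asIdeal.primeCompl (Fin t → N))
  have hAi := OrzechProperty.injective_of_surjective_endomorphism _ hAs
  intro y
  obtain ⟨z, hz⟩ := hs (LocalizedModule.map p.asIdeal.primeCompl A y)
  exact ⟨z, hAi ((hcomp z).symm.trans hz)⟩

/-- The `R`-linear maps underlying the members of a module of `S`-linear maps. -/
def underlying (F : Submodule R (M →ₗ[Sᵐᵒᵖ] N)) : Submodule R (M →ₗ[R] N) :=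
  F.map (LinearMap.restrictScalarsₗ R Sᵐᵒᵖ M N R)

lemma surjectiveAt_iff [Module.Finite R N] (p : PrimeSpectrum R) {t : ℕ}
    (f : Fin t → (M →ₗ[Sᵐᵒᵖ] N)) :
    SurjectiveAt p f ↔ SurjAt p.asIdeal (LinearMap.pi fun i => (f i).restrictScalars R) :=
  (surjAt_iff_localizedModule_map p _).symm

lemma hasSurj_of_le_localCapacity [Module.Finite R N] {F : Submodule R (M →ₗ[Sᵐᵒᵖ] N)}
    {p : PrimeSpectrum R} {s : ℕ} (h : (s : ℕ∞) ≤ localCapacity F p) :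
    HasSurj p.asIdeal s (underlying F) := by
  rcases s with _ | s
  · exact ⟨0, fun i => i.elim0, 1, (Ideal.ne_top_iff_one _).1 p.isPrime.ne_top,
      fun w => ⟨0, Subsingleton.elim _ _⟩⟩
  have hlt : (s : ℕ∞) < localCapacity F p :=
    lt_of_lt_of_le (by exact_mod_cast Nat.lt_succ_self s) h
  unfold localCapacity at hlt
  simp only [lt_iSup_iff] at hlt
  obtain ⟨t, ⟨f, hf, hs⟩, hst⟩ := hlt
  have hst' : s < t := by exact_mod_cast hst
  exact HasSurj.le hst' ⟨fun i => (f i).restrictScalars R, fun i => ⟨f i, hf i, rfl⟩,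
    (surjectiveAt_iff p f).1 hs⟩

lemma surjective_of_surjectiveAt [Module.Finite R N] {t : ℕ} {f : Fin t → (M →ₗ[Sᵐᵒᵖ] N)}
    (h : ∀ p ∈ Module.support R N, p.asIdeal.IsMaximal → SurjectiveAt p f) :
    Function.Surjective (LinearMap.pi f) := by
  intro y
  -- The scalars carrying `y` into the image. Off the support of `N` some scalar outside the maximal
  -- ideal kills `y`, so only maximal ideals in the support matter.
  let J : Ideal R := (LinearMap.range ((LinearMap.pi f).restrictScalars R)).comap
    (LinearMap.toSpanSingleton R (Fin t → N) y)
  suffices J = ⊤ by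
    obtain ⟨x, hx⟩ := (Ideal.eq_top_iff_one J).1 this
    exact ⟨x, by simpa using hx⟩
  by_contra hJ
  obtain ⟨m, hm, hJm⟩ := Ideal.exists_le_maximal J hJ
  let p : PrimeSpectrum R := ⟨m, hm.isPrime⟩
  by_cases hp : p ∈ Module.support R N
  · obtain ⟨r, hr, k⟩ := (surjectiveAt_iff p f).1 (h p hp hm)
    obtain ⟨x, hx⟩ := k y
    exact hr (hJm ⟨x, hx⟩)
  · rw [Module.notMem_support_iff'] at hp
    choose r hr hr0 using fun i => hp (y i)
    have : ∏ i, r i ∈ J := by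
      refine ⟨0, ?_⟩
      rw [map_zero]
      symm
      ext i
      rw [LinearMap.toSpanSingleton_apply, Pi.smul_apply,
        ← Finset.prod_erase_mul _ _ (Finset.mem_univ i), mul_smul, hr0, smul_zero]
      rfl
    obtain ⟨i, -, hi⟩ := (Ideal.IsPrime.prod_mem_iff (hp := hm.isPrime)).1 (hJm this)
    exact hr i hi

theorem exists_surjectiveAt [Module.Finite R N] {F : Submodule R (M →ₗ[Sᵐᵒᵖ] N)} (hF : F.FG)
    {X : Set (PrimeSpectrum R)} (hX : IsBasicSet X) (hdim : topologicalKrullDim ↥X < ⊤) (t : ℕ)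
    (h : ∀ p ∈ X, (t : WithBot ℕ∞) + dimAt X p ≤ ((localCapacity F p : ℕ∞) : WithBot ℕ∞)) :
    ∃ f : Fin t → (M →ₗ[Sᵐᵒᵖ] N), (∀ i, f i ∈ F) ∧ ∀ p ∈ X, SurjectiveAt p f := by
  classical
  choose! δ hδ using fun p (hp : p ∈ X) => exists_dimAt_eq hdim hp
  have hδlt : ∀ p ∈ X, ∀ q ∈ X, q < p → δ p < δ q := fun p hp q hq hqp => by
    have := dimAt_add_one_le hp hq hqp
    rw [hδ p hp, hδ q hq] at this
    exact_mod_cast this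
  have hFR : (underlying F).FG := hF.map _
  obtain ⟨m, f, hf⟩ := Submodule.fg_iff_exists_fin_generating_family.1 hFR
  -- Padding by `t` zeros gives a generating family of length `t + m`, however few generators `F`
  -- has.
  have hspan : Submodule.span R (Set.range (Fin.append (0 : Fin t → (M →ₗ[R] N)) f)) =
      underlying F := by
    rw [← hf]
    refine le_antisymm (Submodule.span_le.2 ?_) (Submodule.span_le.2 ?_)
    · rintro _ ⟨j, rfl⟩
      induction j using Fin.addCases with
      | left j => simp
      | right j => simpa using Submodule.subset_span (Set.mem_range_self j)
    · rintro _ ⟨j, rfl⟩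
      exact Submodule.subset_span ⟨Fin.natAdd t j, by simp⟩
  obtain ⟨g, hg, hs⟩ := exists_tuple_hasSurj hX δ hδlt t m (Fin.append 0 f) fun p hp => by
    rw [hspan]
    refine HasSurj.le (min_le_right _ _) (hasSurj_of_le_localCapacity ?_)
    have := h p hp
    rw [hδ p hp] at this
    exact_mod_cast this
  rw [hspan] at hg
  choose g' hg' hgg using hg
  refine ⟨g', hg', fun p hp => (surjectiveAt_iff p g').2 ?_⟩
  have : (fun i => (g' i).restrictScalars R) = g := funext hgg
  rw [this]
  exact surjAt_of_hasSurj_span p (hs p hp)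

end Capacity

end SurjectiveCapacity

theorem mainTheorem6 {R S M N : Type*} [CommRing R] [Ring S] [Algebra R S] [Module.Finite R S]
    [AddCommGroup M] [Module R M] [Module Sᵐᵒᵖ M] [IsScalarTower R Sᵐᵒᵖ M]
    [AddCommGroup N] [Module R N] [Module Sᵐᵒᵖ N] [IsScalarTower R Sᵐᵒᵖ N]
    [Module.Finite Sᵐᵒᵖ N]
    (L : Submodule Sᵐᵒᵖ M)
    (F : Submodule R (↥L →ₗ[Sᵐᵒᵖ] N)) (hF : F.FG)
    (G : Submodule R (M →ₗ[Sᵐᵒᵖ] N))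
    (hFG : ∀ f ∈ F, ∃ g ∈ G, g ∘ₗ L.subtype = f)
    (X : Set (PrimeSpectrum R)) (hXN : X ⊆ Module.support R N)
    (hX : SurjectiveCapacity.IsBasicSet X) (hdim : topologicalKrullDim ↥X < ⊤) :
    (∀ t : ℕ, 0 < t →
      (∀ p ∈ X, (t : WithBot ℕ∞) + SurjectiveCapacity.dimAt X p
        ≤ ((SurjectiveCapacity.localCapacity F p : ℕ∞) : WithBot ℕ∞)) →
      ∃ g : Fin t → (M →ₗ[Sᵐᵒᵖ] N), (∀ i, g i ∈ G) ∧
        ∀ p ∈ X, SurjectiveCapacity.SurjectiveAt p g) ∧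
    ((∀ p ∈ Module.support R N, p.asIdeal.IsMaximal → p ∈ X) →
      ⨅ p ∈ X, ((SurjectiveCapacity.localCapacity F p : EReal)
          - SurjectiveCapacity.toEReal (SurjectiveCapacity.dimAt X p))
        ≤ (SurjectiveCapacity.globalCapacity G : EReal)) := by

  have : Module.Finite R Sᵐᵒᵖ := Module.Finite.equiv (MulOpposite.opLinearEquiv R)
  have : Module.Finite R N := Module.Finite.trans Sᵐᵒᵖ N
  have main : ∀ t : ℕ,
      (∀ p ∈ X, (t : WithBot ℕ∞) + SurjectiveCapacity.dimAt X p
        ≤ ((SurjectiveCapacity.localCapacity F p : ℕ∞) : WithBot ℕ∞)) →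
      ∃ g : Fin t → (M →ₗ[Sᵐᵒᵖ] N), (∀ i, g i ∈ G) ∧
        ∀ p ∈ X, SurjectiveCapacity.SurjectiveAt p g := by
    intro t ht
    obtain ⟨f, hf, hs⟩ := SurjectiveCapacity.exists_surjectiveAt hF hX hdim t ht
    choose g hg hgf using fun i => hFG (f i) (hf i)
    refine ⟨g, hg, fun p hp => (SurjectiveCapacity.surjectiveAt_iff p g).2 ?_⟩
    obtain ⟨r, hr, k⟩ := (SurjectiveCapacity.surjectiveAt_iff p f).1 (hs p hp)
    refine ⟨r, hr, fun w => ?_⟩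
    obtain ⟨x, hx⟩ := k w
    refine ⟨x, hx ▸ funext fun i => ?_⟩
    exact LinearMap.congr_fun (hgf i) x
  refine ⟨fun t _ => main t, fun hmax => ?_⟩
  by_contra! hlt
  have hne : SurjectiveCapacity.globalCapacity G ≠ ⊤ := by
    intro h
    rw [h] at hlt
    exact absurd hlt (not_lt_of_ge le_top)
  obtain ⟨n, hn⟩ := ENat.ne_top_iff_exists.1 hne
  -- A strict inequality between integers gains one: the capacity would be at least `n + 1`.
  obtain ⟨g, hg, hs⟩ := main (n + 1) fun p hp => by
    have hp' := hlt.trans_le (iInf₂_le p hp)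
    obtain ⟨d, hd⟩ := SurjectiveCapacity.exists_dimAt_eq hdim hp
    rw [← hn, hd] at hp'
    rw [hd]
    generalize SurjectiveCapacity.localCapacity F p = c at hp' ⊢
    induction c with
    | top => exact le_top
    | coe c =>
      have h1 : ((n : ℝ) : EReal) < ((c : ℝ) : EReal) - ((d : ℝ) : EReal) := hp'
      rw [← EReal.coe_sub, EReal.coe_lt_coe_iff, lt_sub_iff_add_lt] at h1
      have h2 : n + d < c := by exact_mod_cast h1
      have h3 : n + 1 + d ≤ c := by omega
      exact_mod_cast h3
  have hsurj := SurjectiveCapacity.surjective_of_surjectiveAt fun p hpN hpm =>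
    hs p (hmax p hpN hpm)
  have hle : ((n + 1 : ℕ) : ℕ∞) ≤ SurjectiveCapacity.globalCapacity G :=
    le_iSup₂_of_le (f := fun (t : ℕ) (_ : ∃ f : Fin t → (M →ₗ[Sᵐᵒᵖ] N),
      (∀ i, f i ∈ G) ∧ Function.Surjective (LinearMap.pi f)) => (t : ℕ∞)) (n + 1) ⟨g, hg, hsurj⟩
      le_rfl
  rw [← hn] at hle
  have : n + 1 ≤ n := by exact_mod_cast hle
  omega
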